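/- Let $l\in\mathbb N$. A preference relation is a complete, transitive, reflexive relation $\succeq$ on $\mathbb R^l_+$; write $x\succ y$ if $x\succeq y$ and not $y\succeq x$. An economy $\mathscr E=((T,\mathscr T,\mu),\omega,\succeq)$ consists of a finite measure space $(T,\mathscr T,\mu)$, an initial allocation $\omega$, and a family $(\succeq_t)_{t\in T}$ of preference relations such that $\{t: x(t)\succ_t y(t)\}$ is measurable for all allocations $x,y$; here an allocation is a measurable, $\mu$-integrable function $T\to\mathbb R^l_+$. An allocation $x$ is feasible if $\int_T x\,d\mu=\int_T\omega\,d\mu$. A coalition is a set $S\in\mathscr T$ with $\mu(S)>0$; it blocks an allocation $x$ if there is an allocation $y$ with $\int_S y\,d\mu=\int_S\omega\,d\mu$ and $y(t)\succ_t x(t)$ for all $t\in S$. The core $C(\mathscr E)$ is the set of feasible allocations that no coalition blocks. An allocation is Pareto optimal if it is not blocked by the coalition $T$. The set $W(\mathscr E)$ of competitive allocations consists of the feasible allocations $x$ for which there is a price system $p\in\mathbb R^l_+$ such that, for $\mu$-almost all $t$, $p\cdot x(t)\le p\cdot\omega(t)$, and every $y\in\mathbb R^l_+$ with $y\succ_t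 x(t)$ satisfies $p\cdot y>p\cdot\omega(t)$. An atom is a set $A\in\mathscr T$ with $\mu(A)>0$ such that every measurable $B\subseteq A$ has $\mu(B)=\mu(A)$ or $\mu(B)=0$; atoms that differ by a null set are identified. **Proposition.** Let $\mathscr E$ be an economy such that: 1. (Monotonicity) for all $t\in T$ and $x,y\in\mathbb R^l_+$ with $x\ne y$ and $x_i\ge y_i$ for all $i$, one has $x\succ_t y$; 2. (Continuity) for all $t\in T$ and $x\in\mathbb R^l_+$, the sets $\{z\in\mathbb R^l_+: x\succ_t z\}$ and $\{z\in\mathbb R^l_+: z\succ_t x\}$ are open in $\mathbb R^l_+$; 3. each component of $\int_T\omega\,d\mu$ is positive; 4. $\mu$ has finitely many atoms, and each atom $A$ has convex preferences: for almost every $t\in A$ and every $x\in\mathbb R^l_+$, the set $\{z\in\mathbb R^l_+: z\succeq_t x\}$ is convex. If $\omega$ is Pareto optimal, then $C(\mathscr E)=W(\mathscr E)$. -/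

import Mathlib

open MeasureTheory

/-- The non-negative orthant of the commodity space `ℝ^l`: the set of commodity bundles that
consumers can hold. It carries the subspace topology, the coordinatewise order and the
subspace Borel σ-algebra. -/
abbrev Orthant (l : ℕ) : Type := {x : Fin l → ℝ // 0 ≤ x}

/-- A preference relation: a complete, transitive and reflexive relation on bundles;
`weak x y` is read "`x` is preferred or indifferent to `y`". -/
structure Preference (l : ℕ) where
  weak : Orthant l → Orthant l → Prop
  refl : ∀ x, weak x x
  trans : ∀ x y z, weak x y → weak y z → weak x z
  total : ∀ x y, weak x y ∨ weak y x

namespace Preference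

variable {l : ℕ}

/-- The induced strict preference. -/
def strict (P : Preference l) (x y : Orthant l) : Prop :=
  P.weak x y ∧ ¬ P.weak y x

/-- Monotonicity: if `x ≥ y` coordinatewise and `x ≠ y`, then `x` is strictly preferred to `y`
(`y < x` is the strict part of the coordinatewise order). -/
def Monotonic (P : Preference l) : Prop :=
  ∀ x y : Orthant l, y < x → P.strict x y

/-- Continuity: strict upper and lower contour sets are open in the orthant. -/
def Continuous (P : Preference l) : Prop :=
  ∀ x : Orthant l, IsOpen {z : Orthant l | P.strict x z} ∧ IsOpen {z : Orthant l | P.strict z x}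

/-- Convexity: for every bundle `x` the set of bundles preferred or indifferent to `x`
is convex. -/
def IsConvex (P : Preference l) : Prop :=
  ∀ x : Orthant l, Convex ℝ ((fun z : Orthant l => (z : Fin l → ℝ)) '' {z | P.weak z x})

end Preference

/-- An allocation: an integrable (in particular measurable) function into the orthant. -/
def IsAllocation {T : Type*} [MeasurableSpace T] {l : ℕ} (μ : Measure T)
    (x : T → Orthant l) : Prop :=
  Measurable x ∧ Integrable (fun t => (x t : Fin l → ℝ)) μ

/-- An atom of a measure: a non-null measurable set every measurable subset of which has
either the full measure or measure zero. -/
def IsMeasureAtom {T : Type*} [MeasurableSpace T] (μ : Measure T) (A : Set T) : Prop :=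
  MeasurableSet A ∧ μ A ≠ 0 ∧ ∀ B ⊆ A, MeasurableSet B → μ B = μ A ∨ μ B = 0

/-- A measure has finitely many atoms, where (as usual) atoms that differ by a null set
are identified. -/
def HasFinitelyManyAtoms {T : Type*} [MeasurableSpace T] (μ : Measure T) : Prop :=
  ∃ F : Set (Set T), F.Finite ∧ (∀ A ∈ F, IsMeasureAtom μ A) ∧
    ∀ A, IsMeasureAtom μ A → ∃ B ∈ F, A =ᵐ[μ] B

/-- An economy with `l` commodities and consumers `T`: a finite measure on `T`, an initial
allocation, and a measurable preference function. -/
structure Economy (T : Type*) [MeasurableSpace T] (l : ℕ) where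
  μ : Measure T
  finite : IsFiniteMeasure μ
  ω : T → Orthant l
  alloc : IsAllocation μ ω
  pref : T → Preference l
  pref_measurable : ∀ x y : T → Orthant l, IsAllocation μ x → IsAllocation μ y →
    MeasurableSet {t | (pref t).strict (x t) (y t)}

namespace Economy

variable {T : Type*} [MeasurableSpace T] {l : ℕ}

/-- Feasible allocations. -/
def IsFeasible (E : Economy T l) (x : T → Orthant l) : Prop :=
  IsAllocation E.μ x ∧ ∫ t, (x t : Fin l → ℝ) ∂E.μ = ∫ t, (E.ω t : Fin l → ℝ) ∂E.μ

/-- A coalition is a measurable set of consumers of positive measure. -/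
def IsCoalition (E : Economy T l) (S : Set T) : Prop :=
  MeasurableSet S ∧ 0 < E.μ S

/-- The coalition `S` blocks `x`. -/
def Blocks (E : Economy T l) (S : Set T) (x : T → Orthant l) : Prop :=
  E.IsCoalition S ∧ ∃ y : T → Orthant l, IsAllocation E.μ y ∧
    ∫ t in S, (y t : Fin l → ℝ) ∂E.μ = ∫ t in S, (E.ω t : Fin l → ℝ) ∂E.μ ∧
    ∀ t ∈ S, (E.pref t).strict (y t) (x t)

/-- The core: feasible allocations not blocked by any coalition. -/
def core (E : Economy T l) : Set (T → Orthant l) :=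
  {x | E.IsFeasible x ∧ ∀ S, ¬ E.Blocks S x}

/-- An allocation is Pareto optimal if the coalition of all consumers does not block it. -/
def IsParetoOptimal (E : Economy T l) (x : T → Orthant l) : Prop :=
  ¬ E.Blocks Set.univ x

/-- A competitive equilibrium `(p, x)`, with price system `p` in the non-negative orthant. -/
def IsCompetitiveEquilibrium (E : Economy T l) (p : Orthant l) (x : T → Orthant l) : Prop :=
  E.IsFeasible x ∧ ∀ᵐ t ∂E.μ,
    (p : Fin l → ℝ) ⬝ᵥ (x t : Fin l → ℝ) ≤ (p : Fin l → ℝ) ⬝ᵥ (E.ω t : Fin l → ℝ) ∧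
    ∀ y : Orthant l, (E.pref t).strict y (x t) →
      (p : Fin l → ℝ) ⬝ᵥ (E.ω t : Fin l → ℝ) < (p : Fin l → ℝ) ⬝ᵥ (y : Fin l → ℝ)

/-- The set of competitive allocations. -/
def competitive (E : Economy T l) : Set (T → Orthant l) :=
  {x | ∃ p : Orthant l, E.IsCompetitiveEquilibrium p x}

end Economy

/-! ### Finite measures without atoms, and weight functions on non-null sets -/

section AtomlessSets

variable {T : Type*} [MeasurableSpace T] {μ : Measure T}

/-! Pareto optimality of `ω` yields one price `p` that decentralizes `ω` itself, and every core
allocation is then competitive at that same `p`.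

To find `p`, consider the net trades that improve on `ω` for a non-null set of consumers. Suppose a
convex combination `∑ wᵢ rᵢ` of such trades were strictly negative. Off the atoms, Sierpiński's
theorem gives disjoint small sets of consumers with measures proportional to the weights, who carry
out the `rᵢ` in full; on the atoms consumers carry out fractions of the trades, which convex
preferences tolerate (`exists_weight_functions`). Nobody is worse off and goods are left over;
sharing them equally makes everybody better off, contradicting optimality. So the convex hull misses
the negative orthant and Hahn–Banach gives `p` (`exists_supporting_price`). Continuity and positive
total endowment make the support strict (`ae_lt_of_supporting_price`).

A core allocation `x` is a.e. at least as good as `ω`, hence costs at least as much; the totals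
agree, so it costs the same. Whatever beats `x` beats `ω`, hence is too expensive
(`mem_competitive_of_mem_core`). The inclusion of `W` in the core is the usual integration of values
over a blocking coalition. -/

theorem measureReal_pos_of_ne_zero [IsFiniteMeasure μ] {S : Set T} (h : μ S ≠ 0) :
    0 < μ.real S :=
  ENNReal.toReal_pos h (measure_ne_top μ S)

/-- A non-atom has a subset of strictly intermediate measure; either it or its complement in `S` has
at most half. -/
theorem exists_subset_measureReal_pos_le_half [IsFiniteMeasure μ] {S : Set T}
    (hS : MeasurableSet S) (h0 : 0 < μ.real S) (hA : ¬ IsMeasureAtom μ S) :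
    ∃ B ⊆ S, MeasurableSet B ∧ 0 < μ.real B ∧ μ.real B ≤ μ.real S / 2 := by
  have hne : μ S ≠ 0 := fun h => by simp [measureReal_def, h] at h0
  simp only [IsMeasureAtom, not_and, not_forall, not_or] at hA
  obtain ⟨B, hBS, hB, h1, h2⟩ := hA hS hne
  have hpos : 0 < μ.real B := measureReal_pos_of_ne_zero h2
  have hdiff : μ.real (S \ B) = μ.real S - μ.real B := measureReal_sdiff hBS hB
  have hlt : μ.real B < μ.real S := by
    refine lt_of_le_of_ne (measureReal_mono hBS) fun h => h1 ?_
    exact (ENNReal.toReal_eq_toReal_iff' (measure_ne_top μ B) (measure_ne_top μ S)).1 h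
  rcases le_total (μ.real B) (μ.real S / 2) with h | h
  · exact ⟨B, hBS, hB, hpos, h⟩
  · exact ⟨S \ B, Set.sdiff_subset, hS.diff hB, by linarith, by linarith⟩

theorem exists_subset_measureReal_pos_le [IsFiniteMeasure μ] {S : Set T}
    (hS : MeasurableSet S) (h0 : 0 < μ.real S) (hA : ∀ A ⊆ S, ¬ IsMeasureAtom μ A)
    {ε : ℝ} (hε : 0 < ε) :
    ∃ B ⊆ S, MeasurableSet B ∧ 0 < μ.real B ∧ μ.real B ≤ ε := by
  have key : ∀ n : ℕ, ∃ B ⊆ S, MeasurableSet B ∧ 0 < μ.real B ∧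
      μ.real B ≤ μ.real S * (1 / 2) ^ n := by
    intro n
    induction n with
    | zero => exact ⟨S, subset_rfl, hS, h0, by simp⟩
    | succ n ih =>
      obtain ⟨B, hBS, hB, hpos, hle⟩ := ih
      obtain ⟨C, hCB, hC, hC0, hCle⟩ :=
        exists_subset_measureReal_pos_le_half hB hpos (hA B hBS)
      exact ⟨C, hCB.trans hBS, hC, hC0, by rw [pow_succ]; linarith⟩
  obtain ⟨n, hn⟩ := exists_pow_lt_of_lt_one (div_pos hε h0) (by norm_num : (1 / 2 : ℝ) < 1)
  obtain ⟨B, hBS, hB, hpos, hle⟩ := key n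
  refine ⟨B, hBS, hB, hpos, hle.trans ?_⟩
  rw [lt_div_iff₀ h0] at hn
  linarith

/-- Sierpiński: on a set without atoms a finite measure takes all intermediate values. -/
theorem exists_subset_measureReal_eq [IsFiniteMeasure μ] {S : Set T}
    (hS : MeasurableSet S) (hA : ∀ A ⊆ S, ¬ IsMeasureAtom μ A)
    {a : ℝ} (ha0 : 0 ≤ a) (ha : a ≤ μ.real S) :
    ∃ D ⊆ S, MeasurableSet D ∧ μ.real D = a := by
  let G : Type _ := {D : Set T // D ⊆ S ∧ MeasurableSet D ∧ μ.real D ≤ a}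
  -- Greedy exhaustion: each step adds at least half of the supremum of the measure that can still
  -- be added without exceeding `a`.
  have step : ∀ D : G, ∃ D' : G, D.1 ⊆ D'.1 ∧ ∀ B ⊆ S \ D.1, MeasurableSet B →
      μ.real D.1 + μ.real B ≤ a → μ.real B ≤ 2 * (μ.real D'.1 - μ.real D.1) := by
    rintro ⟨D, hDS, hD, hDa⟩
    let V : Set ℝ := {b | ∃ B ⊆ S \ D, MeasurableSet B ∧ μ.real D + μ.real B ≤ a ∧ μ.real B = b}
    have hbdd : BddAbove V := ⟨a, by
      rintro _ ⟨B, -, -, h, rfl⟩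
      linarith [measureReal_nonneg (μ := μ) (s := D)]⟩
    have h0V : (0 : ℝ) ∈ V := ⟨∅, Set.empty_subset _, MeasurableSet.empty, by simpa using hDa,
      by simp⟩
    have hnn : 0 ≤ sSup V := le_csSup hbdd h0V
    obtain ⟨_, ⟨B, hB, hBm, hBa, rfl⟩, hle⟩ : ∃ b ∈ V, sSup V / 2 ≤ b := by
      rcases hnn.eq_or_lt with h | h
      · exact ⟨0, h0V, by linarith⟩
      · obtain ⟨b, hb, hlt⟩ := exists_lt_of_lt_csSup ⟨0, h0V⟩ (half_lt_self h)
        exact ⟨b, hb, hlt.le⟩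
    have hun : μ.real (D ∪ B) = μ.real D + μ.real B :=
      measureReal_union (Set.disjoint_left.2 fun t htD htB => (hB htB).2 htD) hBm
    refine ⟨⟨D ∪ B, Set.union_subset hDS (hB.trans Set.sdiff_subset), hD.union hBm,
      hun.trans_le hBa⟩, Set.subset_union_left, fun B' hB' hBm' hBa' => ?_⟩
    have := le_csSup hbdd (show μ.real B' ∈ V from ⟨B', hB', hBm', hBa', rfl⟩)
    simp only [hun]
    linarith
  choose next hsub hnext using step
  let D : ℕ → G := fun n => next^[n] ⟨∅, Set.empty_subset _, MeasurableSet.empty, by simpa using ha0⟩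
  have hDs : ∀ n, D (n + 1) = next (D n) := fun n => Function.iterate_succ_apply' _ _ _
  have hmono : Monotone fun n => (D n).1 := monotone_nat_of_le_succ fun n => by
    rw [hDs]; exact hsub _
  have hlim : Filter.Tendsto (fun n => μ.real (D n).1) Filter.atTop
      (nhds (μ.real (⋃ n, (D n).1))) :=
    (ENNReal.tendsto_toReal (measure_ne_top _ _)).comp (tendsto_measure_iUnion_atTop hmono)
  have hle : μ.real (⋃ n, (D n).1) ≤ a := le_of_tendsto' hlim fun n => (D n).2.2.2
  have hUm : MeasurableSet (⋃ n, (D n).1) := MeasurableSet.iUnion fun n => (D n).2.2.1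
  have hUS : (⋃ n, (D n).1) ⊆ S := Set.iUnion_subset fun n => (D n).2.1
  refine ⟨_, hUS, hUm, hle.antisymm (not_lt.1 fun hlt => ?_)⟩
  have hdiff : μ.real (S \ ⋃ n, (D n).1) = μ.real S - μ.real (⋃ n, (D n).1) :=
    measureReal_sdiff hUS hUm
  -- If the union falls short of `a`, this small `B` outside it could have been added at every
  -- stage, so the increments cannot tend to zero.
  obtain ⟨B, hBS, hB, hB0, hBle⟩ := exists_subset_measureReal_pos_le (hS.diff hUm)
    (by linarith) (fun A h => hA A (h.trans Set.sdiff_subset)) (sub_pos.2 hlt)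
  have hbound : ∀ n, μ.real B ≤ 2 * (μ.real (D (n + 1)).1 - μ.real (D n).1) := by
    intro n
    rw [hDs]
    refine hnext _ B (fun t ht => ⟨(hBS ht).1, fun h => (hBS ht).2 (Set.mem_iUnion.2 ⟨n, h⟩)⟩) hB ?_
    have : μ.real (D n).1 ≤ μ.real (⋃ n, (D n).1) := measureReal_mono (Set.subset_iUnion (fun n => (D n).1) n)
    linarith
  have h2 := ((hlim.comp (Filter.tendsto_add_atTop_nat 1)).sub hlim).const_mul 2
  have := ge_of_tendsto' h2 hbound
  simp only [sub_self, mul_zero] at this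
  linarith

/-- The sets can be chosen one after another: those already chosen occupy at most the sum of their
prescribed measures, so enough of the next `C k` remains. -/
theorem exists_disjoint_subsets_measureReal_eq [IsFiniteMeasure μ] {ι : Type*} [DecidableEq ι]
    (s : Finset ι)
    {C : ι → Set T} (hC : ∀ i ∈ s, MeasurableSet (C i))
    (hA : ∀ i ∈ s, ∀ A ⊆ C i, ¬ IsMeasureAtom μ A)
    {a : ι → ℝ} (ha0 : ∀ i ∈ s, 0 ≤ a i) (ha : ∀ i ∈ s, ∑ j ∈ s, a j ≤ μ.real (C i)) :
    ∃ D : ι → Set T, (∀ i ∈ s, D i ⊆ C i ∧ MeasurableSet (D i) ∧ μ.real (D i) = a i) ∧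
      ∀ i ∈ s, ∀ j ∈ s, i ≠ j → Disjoint (D i) (D j) := by
  induction s using Finset.induction_on with
  | empty => exact ⟨fun _ => ∅, by simp, by simp⟩
  | insert k s hk ih =>
    simp only [Finset.forall_mem_insert, Finset.sum_insert hk] at hC hA ha0 ha
    obtain ⟨D, hD, hdis⟩ := ih hC.2 hA.2 ha0.2 fun i hi => by linarith [ha.2 i hi]
    have hUm : MeasurableSet (⋃ i ∈ s, D i) :=
      Finset.measurableSet_biUnion s fun i hi => (hD i hi).2.1
    have hU : μ.real (⋃ i ∈ s, D i) ≤ ∑ i ∈ s, a i :=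
      (measureReal_biUnion_finset_le s D).trans_eq
        (Finset.sum_congr rfl fun i hi => (hD i hi).2.2)
    have hdiff : μ.real (C k) ≤ μ.real (C k \ ⋃ i ∈ s, D i) + μ.real (⋃ i ∈ s, D i) := by
      refine (measureReal_mono ?_).trans (measureReal_union_le _ _)
      rw [Set.sdiff_union_self]
      exact Set.subset_union_left
    obtain ⟨E, hE, hEm, hEa⟩ := exists_subset_measureReal_eq (μ := μ) (hC.1.diff hUm)
      (fun A h => hA.1 A (h.trans Set.sdiff_subset)) ha0.1 (by linarith [ha.1])
    have hEd : ∀ i ∈ s, Disjoint E (D i) := fun i hi =>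
      Set.disjoint_left.2 fun t ht hti => (hE ht).2 (Set.mem_biUnion hi hti)
    have hne : ∀ i ∈ s, i ≠ k := fun i hi h => hk (h ▸ hi)
    refine ⟨Function.update D k E, ?_, ?_⟩
    · simp only [Finset.forall_mem_insert, Function.update_self]
      refine ⟨⟨hE.trans Set.sdiff_subset, hEm, hEa⟩, fun i hi => ?_⟩
      rw [Function.update_of_ne (hne i hi)]
      exact hD i hi
    · simp only [Finset.forall_mem_insert, Function.update_self]
      refine ⟨⟨by simp, fun i hi _ => ?_⟩, fun i hi => ⟨fun _ => ?_, fun j hj hij => ?_⟩⟩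
      · rw [Function.update_of_ne (hne i hi)]; exact hEd i hi
      · rw [Function.update_of_ne (hne i hi)]; exact (hEd i hi).symm
      · rw [Function.update_of_ne (hne i hi), Function.update_of_ne (hne j hj)]
        exact hdis i hi j hj hij

/-- Weight functions supported in prescribed non-null sets, with integrals proportional to
prescribed convex weights, that are indicators of disjoint sets off `P`. -/
theorem exists_weight_functions [IsFiniteMeasure μ] {ι : Type*} [Fintype ι]
    {P : Set T} (hP : MeasurableSet P) (hA : ∀ A ⊆ Pᶜ, ¬ IsMeasureAtom μ A)
    {B : ι → Set T} (hB : ∀ i, MeasurableSet (B i)) (hB0 : ∀ i, μ (B i) ≠ 0)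
    {w : ι → ℝ} (hw0 : ∀ i, 0 ≤ w i) (hw1 : ∑ i, w i = 1) :
    ∃ η : ℝ, 0 < η ∧ ∃ g : ι → T → ℝ, (∀ i, Measurable (g i)) ∧ (∀ i t, 0 ≤ g i t) ∧
      (∀ t, ∑ i, g i t ≤ 1) ∧ (∀ i t, g i t ≠ 0 → t ∈ B i) ∧ (∀ i, ∫ t, g i t ∂μ = η * w i) ∧
      ∀ t ∉ P, ∀ i, g i t ≠ 0 → g i t = 1 := by
  classical
  have hne : Nonempty ι := by
    by_contra h
    rw [not_nonempty_iff] at h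
    simp at hw1
  -- Indices in `s` are served off `P` by disjoint sets; for the others `B i` lies in `P` up to a
  -- null set and a constant fraction is used.
  let s : Finset ι := Finset.univ.filter fun i => μ (B i ∩ Pᶜ) ≠ 0
  have hs : ∀ i, i ∈ s ↔ μ (B i ∩ Pᶜ) ≠ 0 := fun i => by simp [s]
  let C : ι → Set T := fun i => if i ∈ s then B i ∩ Pᶜ else B i ∩ P
  have hCs : ∀ i ∈ s, C i = B i ∩ Pᶜ := fun i hi => if_pos hi
  have hCn : ∀ i ∉ s, C i = B i ∩ P := fun i hi => if_neg hi
  have hCB : ∀ i, C i ⊆ B i := fun i => by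
    by_cases hi : i ∈ s
    · rw [hCs i hi]; exact Set.inter_subset_left
    · rw [hCn i hi]; exact Set.inter_subset_left
  have hCm : ∀ i, MeasurableSet (C i) := fun i => by
    by_cases hi : i ∈ s
    · rw [hCs i hi]; exact (hB i).inter hP.compl
    · rw [hCn i hi]; exact (hB i).inter hP
  have hC0 : ∀ i, 0 < μ.real (C i) := fun i => by
    apply measureReal_pos_of_ne_zero
    by_cases hi : i ∈ s
    · rw [hCs i hi]; exact (hs i).1 hi
    · rw [hCn i hi]
      intro h
      have h' : μ (B i ∩ Pᶜ) = 0 := not_not.1 (mt (hs i).2 hi)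
      apply hB0 i
      rw [← measure_inter_add_sdiff (B i) hP, h, zero_add]
      exact h'
  -- The scale `η` is the least `μ.real (C i)`: the disjoint sets then fit, and the fractions `η * w
  -- i / μ.real (C i)` are at most `w i`, so they sum to at most 1.
  obtain ⟨k, hk⟩ := Finite.exists_min fun i => μ.real (C i)
  obtain ⟨D, hD, hdis⟩ := exists_disjoint_subsets_measureReal_eq (μ := μ) s (C := C)
    (fun i _ => hCm i)
    (fun i hi A h => hA A (h.trans (by rw [hCs i hi]; exact Set.inter_subset_right)))
    (a := fun i => μ.real (C k) * w i) (fun i _ => mul_nonneg (hC0 k).le (hw0 i)) (by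
      intro i _
      rw [← Finset.mul_sum]
      have h1 : ∑ j ∈ s, w j ≤ 1 := by
        rw [← hw1]
        exact Finset.sum_le_sum_of_subset_of_nonneg (Finset.subset_univ _) fun j _ _ => hw0 j
      calc μ.real (C k) * ∑ j ∈ s, w j ≤ μ.real (C k) * 1 :=
            mul_le_mul_of_nonneg_left h1 (hC0 k).le
        _ ≤ μ.real (C i) := by rw [mul_one]; exact hk i)
  let g : ι → T → ℝ := fun i => if i ∈ s then (D i).indicator fun _ => 1
    else (C i).indicator fun _ => μ.real (C k) * w i / μ.real (C i)
  have hgs : ∀ i ∈ s, g i = (D i).indicator fun _ => 1 := fun i hi => if_pos hi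
  have hgn : ∀ i ∉ s, g i = (C i).indicator fun _ => μ.real (C k) * w i / μ.real (C i) :=
    fun i hi => if_neg hi
  have hcoef : ∀ i, 0 ≤ μ.real (C k) * w i / μ.real (C i) := fun i =>
    div_nonneg (mul_nonneg (hC0 k).le (hw0 i)) (hC0 i).le
  have hg0 : ∀ i t, 0 ≤ g i t := fun i t => by
    by_cases hi : i ∈ s
    · rw [hgs i hi]; exact Set.indicator_nonneg (fun _ _ => zero_le_one) t
    · rw [hgn i hi]; exact Set.indicator_nonneg (fun _ _ => hcoef i) t
  have hgsD : ∀ i ∈ s, ∀ t, g i t ≠ 0 → t ∈ D i := fun i hi t h => by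
    rw [hgs i hi] at h; exact Set.mem_of_indicator_ne_zero h
  have hgnC : ∀ i ∉ s, ∀ t, g i t ≠ 0 → t ∈ B i ∩ P := fun i hi t h => by
    rw [hgn i hi] at h; rw [← hCn i hi]; exact Set.mem_of_indicator_ne_zero h
  have hgsP : ∀ i ∈ s, ∀ t, g i t ≠ 0 → t ∈ B i ∩ Pᶜ := fun i hi t h => by
    rw [← hCs i hi]; exact (hD i hi).1 (hgsD i hi t h)
  refine ⟨μ.real (C k), hC0 k, g, ?_, hg0, ?_, ?_, ?_, ?_⟩
  · intro i
    by_cases hi : i ∈ s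
    · rw [hgs i hi]; exact measurable_const.indicator (hD i hi).2.1
    · rw [hgn i hi]; exact measurable_const.indicator (hCm i)
  · intro t
    by_cases ht : t ∈ P
    · rw [← hw1]
      refine Finset.sum_le_sum fun i _ => ?_
      by_cases hi : i ∈ s
      · by_cases h : g i t = 0
        · rw [h]; exact hw0 i
        · exact absurd ht (hgsP i hi t h).2
      · rw [hgn i hi]
        refine (Set.indicator_apply_le' (fun _ => ?_) fun _ => hw0 i)
        rw [div_le_iff₀ (hC0 i), mul_comm]
        exact mul_le_mul_of_nonneg_left (hk i) (hw0 i)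
    · by_cases h : ∃ i, g i t ≠ 0
      · obtain ⟨i, hi⟩ := h
        have his : i ∈ s := by
          by_contra his
          exact ht (hgnC i his t hi).2
        rw [Finset.sum_eq_single i]
        · rw [hgs i his]
          exact Set.indicator_apply_le' (fun _ => le_rfl) fun _ => zero_le_one
        · intro j _ hji
          by_contra hj
          have hjs : j ∈ s := by
            by_contra hjs
            exact ht (hgnC j hjs t hj).2
          exact Set.disjoint_left.1 (hdis j hjs i his hji) (hgsD j hjs t hj) (hgsD i his t hi)
        · simp
      · push Not at h
        simp [h]
  · intro i t h
    by_cases hi : i ∈ s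
    · exact (hgsP i hi t h).1
    · exact (hgnC i hi t h).1
  · intro i
    by_cases hi : i ∈ s
    · rw [hgs i hi, integral_indicator_const _ (hD i hi).2.1, (hD i hi).2.2]; simp
    · rw [hgn i hi, integral_indicator_const _ (hCm i), smul_eq_mul]
      field_simp [(hC0 i).ne']
  · intro t ht i h
    by_cases hi : i ∈ s
    · rw [hgs i hi, Set.indicator_of_mem (hgsD i hi t h)]
    · exact absurd (hgnC i hi t h).2 ht

end AtomlessSets

/-- The point is a convex combination of the `x + v i` and of `x`, which takes the leftover weight
`1 - ∑ g i`. -/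
theorem Convex.add_sum_smul_mem {V : Type*} [AddCommGroup V] [Module ℝ V] {s : Set V}
    (hs : Convex ℝ s) {ι : Type*} [Fintype ι] {x : V} (hx : x ∈ s) {g : ι → ℝ} {v : ι → V}
    (h0 : ∀ i, 0 ≤ g i) (h1 : ∑ i, g i ≤ 1) (hv : ∀ i, g i ≠ 0 → x + v i ∈ s) :
    x + ∑ i, g i • v i ∈ s := by
  classical
  -- Where `g i = 0`, `x + v i` may lie outside `s`, so `x` stands in for it.
  let z : Option ι → V := fun o => o.elim x fun i => if g i = 0 then x else x + v i
  let w : Option ι → ℝ := fun o => o.elim (1 - ∑ i, g i) g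
  have hmem : ∑ o, w o • z o ∈ s := by
    refine hs.sum_mem ?_ ?_ ?_
    · rintro (_ | i) -
      · exact sub_nonneg.2 h1
      · exact h0 i
    · simp [w, Fintype.sum_option]
    · rintro (_ | i) -
      · exact hx
      · by_cases h : g i = 0
        · simpa [z, h] using hx
        · simpa [z, h] using hv i h
  convert hmem using 1
  rw [Fintype.sum_option]
  have : ∀ i, w (some i) • z (some i) = g i • x + g i • v i := fun i => by
    by_cases h : g i = 0
    · simp [w, h]
    · simp [w, z, h]
  simp only [this, Finset.sum_add_distrib, ← Finset.sum_smul]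
  simp only [w, z, Option.elim, sub_smul, one_smul]
  abel

/-! ### Preference relations -/

namespace Preference

variable {l : ℕ} {P : Preference l} {x y z : Orthant l}

theorem strict_of_strict_of_weak (h : P.strict x y) (h' : P.weak y z) : P.strict x z :=
  ⟨P.trans _ _ _ h.1 h', fun hzx => h.2 (P.trans _ _ _ h' hzx)⟩

theorem strict_of_weak_of_strict (h : P.weak x y) (h' : P.strict y z) : P.strict x z :=
  ⟨P.trans _ _ _ h h'.1, fun hzx => h'.2 (P.trans _ _ _ hzx h)⟩

theorem weak_of_not_strict (h : ¬ P.strict x y) : P.weak y x := by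
  by_contra hyx
  exact h ⟨(P.total x y).resolve_right hyx, hyx⟩

theorem Monotonic.weak_of_le (hP : P.Monotonic) (h : y ≤ x) : P.weak x y := by
  rcases h.eq_or_lt with rfl | h
  · exact P.refl _
  · exact (hP _ _ h).1

/-- A preferred bundle stays preferred after a suitable proportional reduction. -/
theorem Continuous.exists_smul_strict (hP : P.Continuous) (h : P.strict y x) :
    ∃ c : ℝ, 0 ≤ c ∧ c < 1 ∧ ∃ y' : Orthant l,
      (y' : Fin l → ℝ) = c • (y : Fin l → ℝ) ∧ P.strict y' x := by
  -- Clipping `c` at 0 makes the scaling a continuous map from all of `ℝ` into the orthant.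
  let φ : ℝ → Orthant l := fun c => ⟨max c 0 • (y : Fin l → ℝ),
    smul_nonneg (le_max_right _ _) y.2⟩
  have hφ : _root_.Continuous φ := by
    refine Continuous.subtype_mk ?_ _
    fun_prop
  have hφ1 : φ 1 = y := Subtype.ext (by simp [φ])
  have hopen : IsOpen (φ ⁻¹' {z | P.strict z x}) := (hP x).2.preimage hφ
  have hmem : (1 : ℝ) ∈ φ ⁻¹' {z | P.strict z x} := by
    rw [Set.mem_preimage, hφ1]; exact h
  obtain ⟨ε, hε, hball⟩ := Metric.isOpen_iff.1 hopen 1 hmem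
  have hd : 0 < min (ε / 2) (1 / 2) := lt_min (half_pos hε) (by norm_num)
  have hd1 : min (ε / 2) (1 / 2) ≤ 1 / 2 := min_le_right _ _
  have hd2 : min (ε / 2) (1 / 2) ≤ ε / 2 := min_le_left _ _
  have hc : 0 ≤ 1 - min (ε / 2) (1 / 2) := by linarith
  refine ⟨1 - min (ε / 2) (1 / 2), hc, by linarith, φ (1 - min (ε / 2) (1 / 2)), ?_, ?_⟩
  · simp only [φ, max_eq_left hc]
  · apply hball
    rw [Metric.mem_ball, Real.dist_eq, abs_lt]
    constructor <;> linarith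

end Preference

/-! ### Values of allocations and the inclusion of competitive allocations in the core -/

namespace Economy

variable {T : Type*} [MeasurableSpace T] {l : ℕ}

/-- The bundle obtained from an arbitrary vector by truncating negative coordinates. -/
def truncate (v : Fin l → ℝ) : Orthant l := ⟨v ⊔ 0, le_sup_right⟩

theorem coe_truncate {v : Fin l → ℝ} (h : 0 ≤ v) : (truncate v : Fin l → ℝ) = v :=
  sup_eq_left.2 h

theorem isAllocation_truncate {μ : Measure T} {f : T → Fin l → ℝ} (hf : Measurable f)
    (hi : Integrable f μ) : IsAllocation μ fun t => truncate (f t) := by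
  refine ⟨Measurable.subtype_mk (measurable_pi_lambda _ fun i =>
    ((measurable_pi_apply i).comp hf).max measurable_const), ?_⟩
  have : (fun t => (truncate (f t) : Fin l → ℝ)) = fun t i => max (f t i) 0 := by
    ext t i; simp [truncate]
  rw [this]
  exact Integrable.of_eval fun i => (hi.eval i).pos_part

theorem measurable_coe_alloc {μ : Measure T} {x : T → Orthant l} (h : IsAllocation μ x) :
    Measurable fun t => (x t : Fin l → ℝ) :=
  measurable_subtype_coe.comp h.1

theorem integrable_dotProduct {μ : Measure T} (p : Fin l → ℝ) {f : T → Fin l → ℝ}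
    (hf : Integrable f μ) : Integrable (fun t => p ⬝ᵥ f t) μ := by
  simp only [dotProduct]
  exact integrable_finsetSum _ fun i _ => (hf.eval i).const_mul _

theorem integral_dotProduct {μ : Measure T} (p : Fin l → ℝ) {f : T → Fin l → ℝ}
    (hf : Integrable f μ) : ∫ t, p ⬝ᵥ f t ∂μ = p ⬝ᵥ ∫ t, f t ∂μ := by
  simp only [dotProduct]
  rw [integral_finsetSum _ fun i _ => (hf.eval i).const_mul _]
  refine Finset.sum_congr rfl fun i _ => ?_
  rw [integral_const_mul, eval_integral fun i => hf.eval i]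

theorem competitive_subset_core (E : Economy T l) : E.competitive ⊆ E.core := by
  rintro x ⟨p, hx, hp⟩
  refine ⟨hx, ?_⟩
  rintro S ⟨⟨hS, hS0⟩, y, hy, hint, hpref⟩
  have hyi := integrable_dotProduct (p : Fin l → ℝ) (hy.2.mono_measure (Measure.restrict_le_self (s := S)))
  have hωi := integrable_dotProduct (p : Fin l → ℝ) (E.alloc.2.mono_measure (Measure.restrict_le_self (s := S)))
  have hlt : ∀ᵐ t ∂E.μ.restrict S, 0 < (p : Fin l → ℝ) ⬝ᵥ (y t : Fin l → ℝ) -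
      (p : Fin l → ℝ) ⬝ᵥ (E.ω t : Fin l → ℝ) := by
    filter_upwards [ae_restrict_of_ae hp, ae_restrict_mem hS] with t ht htS
    exact sub_pos.2 (ht.2 _ (hpref t htS))
  have hpos : 0 < ∫ t in S, ((p : Fin l → ℝ) ⬝ᵥ (y t : Fin l → ℝ) -
      (p : Fin l → ℝ) ⬝ᵥ (E.ω t : Fin l → ℝ)) ∂E.μ := by
    have hnn := hlt.mono fun t h => h.le
    refine (integral_nonneg_of_ae hnn).lt_of_ne' fun h0 => ?_
    rw [integral_eq_zero_iff_of_nonneg_ae hnn (hyi.sub hωi)] at h0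
    have hF : ∀ᵐ t ∂E.μ.restrict S, False := by
      filter_upwards [hlt, h0] with t h1 h2
      exact h1.ne' h2
    rw [ae_iff] at hF
    simp only [not_false_eq_true, Set.ofPred_true, Measure.restrict_apply_univ] at hF
    exact hS0.ne' hF
  rw [integral_sub hyi hωi,
    integral_dotProduct _ (hy.2.mono_measure Measure.restrict_le_self),
    integral_dotProduct _ (E.alloc.2.mono_measure Measure.restrict_le_self), hint, sub_self] at hpos
  exact lt_irrefl _ hpos

/-- A Pareto optimal allocation cannot be improved upon almost everywhere. -/
theorem IsParetoOptimal.not_ae_strict {E : Economy T l} [Nonempty (Fin l)]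
    (hmono : ∀ t, (E.pref t).Monotonic) {x : T → Orthant l} (h : E.IsParetoOptimal x)
    (hx : IsAllocation E.μ x) (h0 : E.μ Set.univ ≠ 0) {y : T → Orthant l}
    (hy : IsAllocation E.μ y)
    (hint : ∫ t, (y t : Fin l → ℝ) ∂E.μ = ∫ t, (E.ω t : Fin l → ℝ) ∂E.μ) :
    ¬ ∀ᵐ t ∂E.μ, (E.pref t).strict (y t) (x t) := by
  classical
  have := E.finite
  intro hae
  have hSm : MeasurableSet {t | (E.pref t).strict (y t) (x t)} := E.pref_measurable y x hy hx
  let up : T → Orthant l := fun t => ⟨(x t : Fin l → ℝ) + 1, add_nonneg (x t).2 zero_le_one⟩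
  have hup : Measurable up :=
    Measurable.subtype_mk ((measurable_coe_alloc hx).add_const 1)
  -- Blocking demands improvement for every consumer, so on the exceptional null set `y` is replaced
  -- by `x + 1`.
  let z : T → Orthant l := fun t => if (E.pref t).strict (y t) (x t) then y t else up t
  have hzy : (fun t => (z t : Fin l → ℝ)) =ᵐ[E.μ] fun t => (y t : Fin l → ℝ) := by
    filter_upwards [hae] with t ht
    simp only [z, if_pos ht]
  refine h ⟨⟨MeasurableSet.univ, pos_iff_ne_zero.2 h0⟩, z, ⟨Measurable.ite hSm hy.1 hup,
    hy.2.congr hzy.symm⟩, ?_, fun t _ => ?_⟩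
  · rw [Measure.restrict_univ, integral_congr_ae hzy, hint]
  · by_cases ht : (E.pref t).strict (y t) (x t)
    · simpa only [z, if_pos ht] using ht
    · simp only [z, if_neg ht]
      refine hmono t _ _ (show (x t : Fin l → ℝ) < (x t : Fin l → ℝ) + 1 from ?_)
      exact lt_add_of_pos_right _ one_pos

end Economy

/-! ### The price system supporting the initial allocation -/

namespace Economy

variable {T : Type*} [MeasurableSpace T] {l : ℕ}

/-- The consumers for whom the net trade `r` is possible and improves on the initial bundle. -/
def improvers (E : Economy T l) (r : Fin l → ℝ) : Set T :=
  {t | 0 ≤ (E.ω t : Fin l → ℝ) + r ∧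
    (E.pref t).strict (truncate ((E.ω t : Fin l → ℝ) + r)) (E.ω t)}

theorem measurableSet_improvers (E : Economy T l) (r : Fin l → ℝ) :
    MeasurableSet (E.improvers r) := by
  have := E.finite
  have hm : Measurable fun t => (E.ω t : Fin l → ℝ) + r := (measurable_coe_alloc E.alloc).add_const r
  refine MeasurableSet.inter (hm measurableSet_Ici) ?_
  exact E.pref_measurable _ _
    (isAllocation_truncate hm (E.alloc.2.add (integrable_const r))) E.alloc

/-- No convex combination of improving net trades is strictly negative. -/
theorem IsParetoOptimal.not_forall_neg_of_mem_convexHull {E : Economy T l} [Nonempty (Fin l)]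
    (hmono : ∀ t, (E.pref t).Monotonic) (h0 : E.μ Set.univ ≠ 0) (h : E.IsParetoOptimal E.ω)
    {P : Set T} (hP : MeasurableSet P) (hA : ∀ A ⊆ Pᶜ, ¬ IsMeasureAtom E.μ A)
    (hconv : ∀ᵐ t ∂E.μ, t ∈ P → (E.pref t).IsConvex)
    {v : Fin l → ℝ} (hv : v ∈ convexHull ℝ {r | E.μ (E.improvers r) ≠ 0}) :
    ¬ ∀ i, v i < 0 := by
  have := E.finite
  intro hneg
  obtain ⟨ι, _, w, r, hw0, hw1, hr, rfl⟩ := mem_convexHull_iff_exists_fintype.1 hv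
  obtain ⟨η, hη, g, hgm, hg0, hg1, hgB, hgint, hgP⟩ := exists_weight_functions (μ := E.μ) hP hA
    (fun i => E.measurableSet_improvers (r i)) hr hw0 hw1
  set v := ∑ i, w i • r i with hvdef
  let m : ℝ := E.μ.real Set.univ
  have hm : 0 < m := measureReal_pos_of_ne_zero h0
  let f : T → Fin l → ℝ := fun t => (E.ω t : Fin l → ℝ) + ∑ i, g i t • r i
  -- The trades sum to `η • v < 0`; `c` hands the surplus `-η • v` back in equal shares.
  let c : Fin l → ℝ := (-(η / m)) • v
  have hc : ∀ i, 0 < c i := fun i => by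
    have := mul_pos (div_pos hη hm) (neg_pos.2 (hneg i))
    simp only [c, Pi.smul_apply, smul_eq_mul]
    linarith
  have hgi : ∀ i, Integrable (g i) E.μ := fun i => by
    refine Integrable.of_bound (hgm i).aestronglyMeasurable 1 (ae_of_all _ fun t => ?_)
    rw [Real.norm_of_nonneg (hg0 i t)]
    exact (Finset.single_le_sum (fun j _ => hg0 j t) (Finset.mem_univ i)).trans (hg1 t)
  have hsi : Integrable (fun t => ∑ i, g i t • r i) E.μ :=
    integrable_finsetSum _ fun i _ => (hgi i).smul_const (r i)
  have hsint : ∫ t, ∑ i, g i t • r i ∂E.μ = η • v := by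
    rw [integral_finsetSum _ fun i _ => (hgi i).smul_const (r i), hvdef, Finset.smul_sum]
    refine Finset.sum_congr rfl fun i _ => ?_
    rw [integral_smul_const, hgint, mul_smul]
  have hfm : Measurable f := (measurable_coe_alloc E.alloc).add
    (Finset.measurable_sum _ fun i _ => (hgm i).smul_const (r i))
  have hfi : Integrable f E.μ := E.alloc.2.add hsi
  have hfU : ∀ᵐ t ∂E.μ, f t ∈ (fun z : Orthant l => (z : Fin l → ℝ)) ''
      {z | (E.pref t).weak z (E.ω t)} := by
    filter_upwards [hconv] with t ht
    have hr' : ∀ i, g i t ≠ 0 → (E.ω t : Fin l → ℝ) + r i ∈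
        (fun z : Orthant l => (z : Fin l → ℝ)) '' {z | (E.pref t).weak z (E.ω t)} := fun i hi =>
      ⟨_, (hgB i t hi).2.1, coe_truncate (hgB i t hi).1⟩
    have hω' : (E.ω t : Fin l → ℝ) ∈
        (fun z : Orthant l => (z : Fin l → ℝ)) '' {z | (E.pref t).weak z (E.ω t)} :=
      ⟨_, (E.pref t).refl _, rfl⟩
    -- On `P` convexity applies. Off `P` at most one weight is nonzero, and it is 1, so the consumer
    -- makes one whole improving trade or none.
    by_cases htP : t ∈ P
    · exact (ht htP (E.ω t)).add_sum_smul_mem hω' (fun i => hg0 i t) (hg1 t) hr'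
    · by_cases hex : ∃ i, g i t ≠ 0
      · obtain ⟨i, hi⟩ := hex
        have hi1 := hgP t htP i hi
        have hz : ∀ j, j ≠ i → g j t = 0 := fun j hji => by
          classical
          refine le_antisymm ?_ (hg0 j t)
          have h2 := Finset.sum_le_sum_of_subset_of_nonneg (Finset.subset_univ {i, j})
            fun k _ _ => hg0 k t
          rw [Finset.sum_pair hji.symm] at h2
          linarith [hg1 t]
        have : f t = (E.ω t : Fin l → ℝ) + r i := by
          simp only [f]
          rw [Finset.sum_eq_single i (fun j _ hji => by rw [hz j hji, zero_smul]) (by simp),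
            hi1, one_smul]
        rw [this]
        exact hr' i hi
      · push Not at hex
        simpa [f, hex] using hω'
  let y : T → Orthant l := fun t => truncate (f t + c)
  have hyf : ∀ᵐ t ∂E.μ, (y t : Fin l → ℝ) = f t + c := by
    filter_upwards [hfU] with t ⟨z, _, hz⟩
    refine coe_truncate (add_nonneg ?_ fun i => (hc i).le)
    rw [← hz]; exact z.2
  refine h.not_ae_strict hmono E.alloc h0 (y := y)
    (isAllocation_truncate (hfm.add_const c) (hfi.add (integrable_const c))) ?_ ?_
  · rw [integral_congr_ae hyf, integral_add hfi (integrable_const c), integral_const,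
      integral_add E.alloc.2 hsi, hsint]
    change _ + η • v + m • c = _
    rw [smul_smul, show m * -(η / m) = -η by field_simp, neg_smul]
    abel
  · filter_upwards [hfU, hyf] with t ⟨z, hz, hzf⟩ hyt
    refine Preference.strict_of_strict_of_weak (hmono t _ z ?_) hz
    change (z : Fin l → ℝ) < (y t : Fin l → ℝ)
    rw [hyt, ← hzf]
    exact lt_add_of_pos_right _ (lt_of_strongLT hc)

/-- A Pareto optimal initial allocation is supported by a non-zero price system. -/
theorem IsParetoOptimal.exists_supporting_price {E : Economy T l} [Nonempty (Fin l)]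
    (hmono : ∀ t, (E.pref t).Monotonic) (h0 : E.μ Set.univ ≠ 0) (h : E.IsParetoOptimal E.ω)
    {P : Set T} (hP : MeasurableSet P) (hA : ∀ A ⊆ Pᶜ, ¬ IsMeasureAtom E.μ A)
    (hconv : ∀ᵐ t ∂E.μ, t ∈ P → (E.pref t).IsConvex) :
    ∃ p : Fin l → ℝ, 0 ≤ p ∧ p ≠ 0 ∧ ∀ᵐ t ∂E.μ, ∀ y : Orthant l, (E.pref t).strict y (E.ω t) →
      p ⬝ᵥ (E.ω t : Fin l → ℝ) ≤ p ⬝ᵥ (y : Fin l → ℝ) := by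
  let N : Set (Fin l → ℝ) := Set.univ.pi fun _ => Set.Iio 0
  have hNmem : ∀ v, v ∈ N ↔ ∀ i, v i < 0 := fun v => by simp [N]
  have hNconv : Convex ℝ N := convex_pi fun _ _ => convex_Iio 0
  have hNopen : IsOpen N := isOpen_set_pi Set.finite_univ fun _ _ => isOpen_Iio
  obtain ⟨φ, u, hφN, hφK⟩ := geometric_hahn_banach_open hNconv hNopen
    (convex_convexHull ℝ {r | E.μ (E.improvers r) ≠ 0})
    (Set.disjoint_left.2 fun v hv hv' =>
      h.not_forall_neg_of_mem_convexHull hmono h0 hP hA hconv hv' ((hNmem v).1 hv))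
  let p : Fin l → ℝ := fun i => φ (Pi.single i 1)
  have hφ : ∀ v, φ v = p ⬝ᵥ v := fun v => by
    conv_lhs => rw [pi_eq_sum_univ' v]
    simp [p, dotProduct, mul_comm]
  have hcl : ∀ v : Fin l → ℝ, v ≤ 0 → p ⬝ᵥ v ≤ u := by
    intro v hv
    have ht : Filter.Tendsto (fun ε : ℝ => φ (v - ε • 1)) (nhdsWithin 0 (Set.Ioi 0)) (nhds (φ v)) := by
      have : ContinuousAt (fun ε : ℝ => φ (v - ε • 1)) 0 := by fun_prop
      simpa using this.tendsto.mono_left nhdsWithin_le_nhds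
    rw [← hφ]
    refine le_of_tendsto ht ?_
    filter_upwards [self_mem_nhdsWithin] with ε hε
    refine (hφN _ ((hNmem _).2 fun i => ?_)).le
    have h1 : v i ≤ 0 := hv i
    have h2 : (0 : ℝ) < ε := hε
    simp only [Pi.sub_apply, Pi.smul_apply, Pi.one_apply, smul_eq_mul, mul_one]
    linarith
  have hu : 0 ≤ u := by simpa using hcl 0 le_rfl
  have hp : 0 ≤ p := fun i => by
    by_contra hi
    have hi' : p i < 0 := not_le.1 hi
    -- This vector is nonpositive, yet has value `u + 1`.
    have := hcl (-((u + 1) / (-p i)) • Pi.single i 1) (fun j => by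
      by_cases hj : j = i
      · subst hj
        have : 0 ≤ (u + 1) / (-p j) := div_nonneg (by linarith) (by linarith)
        simpa using this
      · simp [hj])
    rw [dotProduct_smul, dotProduct_single, mul_one, smul_eq_mul, div_neg, neg_neg,
      div_mul_cancel₀ _ hi'.ne] at this
    linarith
  have hp0 : p ≠ 0 := by
    intro hp0
    have h1 : φ (-1) < u := hφN _ ((hNmem _).2 fun i => by simp)
    have hmem : (1 : Fin l → ℝ) ∈ {r | E.μ (E.improvers r) ≠ 0} := by
      have : E.improvers 1 = Set.univ := by
        refine Set.eq_univ_of_forall fun t => ?_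
        have hnn : 0 ≤ (E.ω t : Fin l → ℝ) + 1 := add_nonneg (E.ω t).2 zero_le_one
        refine ⟨hnn, hmono t _ _ ?_⟩
        change (E.ω t : Fin l → ℝ) < (truncate ((E.ω t : Fin l → ℝ) + 1) : Orthant l).1
        rw [coe_truncate hnn]
        exact lt_add_of_pos_right _ one_pos
      simpa only [Set.mem_ofPred_eq, this] using h0
    have h2 := hφK _ (subset_convexHull ℝ _ hmem)
    rw [hφ, hp0, zero_dotProduct] at h1 h2
    linarith
  refine ⟨p, hp, hp0, ?_⟩
  -- Rational trades are countably many, so the null sets of improvers among them can be discarded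
  -- all at once.
  have hq : ∀ᵐ t ∂E.μ, ∀ q : Fin l → ℚ, t ∈ E.improvers (fun i => (q i : ℝ)) →
      0 ≤ p ⬝ᵥ fun i => (q i : ℝ) := by
    rw [ae_all_iff]
    intro q
    by_cases hz : E.μ (E.improvers fun i => (q i : ℝ)) = 0
    · have : ∀ᵐ t ∂E.μ, t ∉ E.improvers fun i => (q i : ℝ) := measure_eq_zero_iff_ae_notMem.1 hz
      filter_upwards [this] with t ht ht'
      exact absurd ht' ht
    · refine ae_of_all _ fun t _ => ?_
      rw [← hφ]
      exact hu.trans (hφK _ (subset_convexHull ℝ _ hz))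
  filter_upwards [hq] with t ht y hy
  have hstep : ∀ ε : ℝ, 0 < ε →
      0 ≤ p ⬝ᵥ ((y : Fin l → ℝ) - (E.ω t : Fin l → ℝ) + ε • 1) := by
    intro ε hε
    -- Rounding the trade up to a rational one keeps it possible and, by monotonicity, improving.
    choose q hq1 hq2 using fun i : Fin l => exists_rat_btwn
      (lt_add_of_pos_right ((y : Fin l → ℝ) i - (E.ω t : Fin l → ℝ) i) hε)
    have hle : (y : Fin l → ℝ) ≤ (E.ω t : Fin l → ℝ) + fun i => (q i : ℝ) := fun i => by
      have := hq1 i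
      simp only [Pi.add_apply]
      linarith
    have hnn := y.2.trans hle
    refine (ht q ⟨hnn, Preference.strict_of_weak_of_strict ((hmono t).weak_of_le ?_) hy⟩).trans ?_
    · change (y : Fin l → ℝ) ≤ (truncate _ : Orthant l).1
      rw [coe_truncate hnn]
      exact hle
    · refine dotProduct_le_dotProduct_of_nonneg_left (fun i => ?_) hp
      have := hq2 i
      simp only [Pi.add_apply, Pi.sub_apply, Pi.smul_apply, Pi.one_apply, smul_eq_mul, mul_one]
      linarith
  have hlim : Filter.Tendsto
      (fun ε : ℝ => p ⬝ᵥ ((y : Fin l → ℝ) - (E.ω t : Fin l → ℝ) + ε • 1))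
      (nhdsWithin 0 (Set.Ioi 0)) (nhds (p ⬝ᵥ ((y : Fin l → ℝ) - (E.ω t : Fin l → ℝ)))) := by
    have : ContinuousAt (fun ε : ℝ => φ ((y : Fin l → ℝ) - (E.ω t : Fin l → ℝ) + ε • 1)) 0 := by
      fun_prop
    simpa [← hφ] using this.tendsto.mono_left nhdsWithin_le_nhds
  have := ge_of_tendsto hlim (by filter_upwards [self_mem_nhdsWithin] with ε hε using hstep ε hε)
  rw [dotProduct_sub] at this
  linarith

/-- A price system supporting the initial allocation supports it strictly. -/
theorem ae_lt_of_supporting_price {E : Economy T l} (hmono : ∀ t, (E.pref t).Monotonic)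
    (hcont : ∀ t, (E.pref t).Continuous)
    (hpos : ∀ i : Fin l, 0 < (∫ t, (E.ω t : Fin l → ℝ) ∂E.μ) i)
    {p : Fin l → ℝ} (hp : 0 ≤ p) (hp0 : p ≠ 0)
    (hsupp : ∀ᵐ t ∂E.μ, ∀ y : Orthant l, (E.pref t).strict y (E.ω t) →
      p ⬝ᵥ (E.ω t : Fin l → ℝ) ≤ p ⬝ᵥ (y : Fin l → ℝ)) :
    ∀ᵐ t ∂E.μ, ∀ y : Orthant l, (E.pref t).strict y (E.ω t) →
      p ⬝ᵥ (E.ω t : Fin l → ℝ) < p ⬝ᵥ (y : Fin l → ℝ) := by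
  -- With positive wealth, `c • y` with `c < 1` is still preferred, so `c * (p ⬝ᵥ y)` is at least
  -- the wealth and `y` costs strictly more.
  have hrich : ∀ t, (∀ y : Orthant l, (E.pref t).strict y (E.ω t) →
      p ⬝ᵥ (E.ω t : Fin l → ℝ) ≤ p ⬝ᵥ (y : Fin l → ℝ)) → 0 < p ⬝ᵥ (E.ω t : Fin l → ℝ) →
      ∀ y : Orthant l, (E.pref t).strict y (E.ω t) →
        p ⬝ᵥ (E.ω t : Fin l → ℝ) < p ⬝ᵥ (y : Fin l → ℝ) := by
    intro t ht hw y hy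
    obtain ⟨c, hc0, hc1, y', hy', hs⟩ := (hcont t).exists_smul_strict hy
    have h1 := ht y' hs
    rw [hy', dotProduct_smul, smul_eq_mul] at h1
    nlinarith [dotProduct_nonneg_of_nonneg hp y.2]
  obtain ⟨k, hk⟩ := Function.ne_iff.1 hp0
  have hk : 0 < p k := lt_of_le_of_ne (hp k) (Ne.symm hk)
  have hvalue : 0 < ∫ t, p ⬝ᵥ (E.ω t : Fin l → ℝ) ∂E.μ := by
    rw [integral_dotProduct p E.alloc.2]
    exact Finset.sum_pos' (fun i _ => mul_nonneg (hp i) (hpos i).le)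
      ⟨k, Finset.mem_univ k, mul_pos hk (hpos k)⟩
  -- If good `i` were free, a consumer of positive wealth could improve at no cost; so wealth would
  -- vanish a.e., although the total endowment has positive value.
  have hppos : ∀ i, 0 < p i := by
    intro i
    by_contra hi
    have hi : p i = 0 := le_antisymm (not_lt.1 hi) (hp i)
    have hle : ∫ t, p ⬝ᵥ (E.ω t : Fin l → ℝ) ∂E.μ ≤ 0 := by
      refine integral_nonpos_of_ae ?_
      filter_upwards [hsupp] with t ht
      by_contra hw
      let y : Orthant l := ⟨(E.ω t : Fin l → ℝ) + Pi.single i 1,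
        add_nonneg (E.ω t).2 (Pi.single_nonneg.2 zero_le_one)⟩
      have hlt := hrich t ht (not_le.1 hw) y (hmono t _ _
        (show (E.ω t : Fin l → ℝ) < (E.ω t : Fin l → ℝ) + Pi.single i 1 from
          lt_add_of_pos_right _ (Pi.single_pos.2 one_pos)))
      simp [y, dotProduct_add, hi] at hlt
    exact hle.not_gt hvalue
  have hzero : ∀ z : Orthant l, p ⬝ᵥ (z : Fin l → ℝ) ≤ 0 → z = 0 := by
    intro z hz
    have hnn : ∀ i ∈ Finset.univ, 0 ≤ p i * (z : Fin l → ℝ) i := fun i _ =>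
      mul_nonneg (hp i) (z.2 i)
    have h0 := (Finset.sum_eq_zero_iff_of_nonneg hnn).1 (hz.antisymm (Finset.sum_nonneg hnn))
    ext i
    exact (mul_eq_zero.1 (h0 i (Finset.mem_univ i))).resolve_left (hppos i).ne'
  filter_upwards [hsupp] with t ht y hy
  rcases (dotProduct_nonneg_of_nonneg hp (E.ω t).2).lt_or_eq with hw | hw
  · exact hrich t ht hw y hy
  -- At zero wealth and positive prices the only affordable bundle is 0, which is the endowment
  -- itself.
  · rw [← hw]
    by_contra hy0
    have h1 := hzero y (not_lt.1 hy0)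
    have h2 := hzero (E.ω t) hw.ge
    rw [h1, h2] at hy
    exact hy.2 hy.1

/-! ### Core allocations at a supporting price, and the conclusion -/

/-- A core allocation is competitive at any price system that strictly supports the initial
allocation. -/
theorem mem_competitive_of_mem_core {E : Economy T l} [Nonempty (Fin l)]
    (hmono : ∀ t, (E.pref t).Monotonic) {p : Fin l → ℝ} (hp : 0 ≤ p)
    (hsupp : ∀ᵐ t ∂E.μ, ∀ y : Orthant l, (E.pref t).strict y (E.ω t) →
      p ⬝ᵥ (E.ω t : Fin l → ℝ) < p ⬝ᵥ (y : Fin l → ℝ))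
    {x : T → Orthant l} (hx : x ∈ E.core) : x ∈ E.competitive := by
  obtain ⟨⟨hxa, hxint⟩, hcore⟩ := hx
  have hweak : ∀ᵐ t ∂E.μ, (E.pref t).weak (x t) (E.ω t) := by
    have hnull : E.μ {t | (E.pref t).strict (E.ω t) (x t)} = 0 := by
      -- Consumers who strictly prefer their endowment would block by keeping it.
      by_contra hne
      exact hcore _ ⟨⟨E.pref_measurable _ _ E.alloc hxa, pos_iff_ne_zero.2 hne⟩, E.ω, E.alloc,
        rfl, fun t ht => ht⟩
    filter_upwards [measure_eq_zero_iff_ae_notMem.1 hnull] with t ht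
    exact Preference.weak_of_not_strict ht
  have hge : ∀ᵐ t ∂E.μ, p ⬝ᵥ (E.ω t : Fin l → ℝ) ≤ p ⬝ᵥ (x t : Fin l → ℝ) := by
    filter_upwards [hweak, hsupp] with t hw hs
    -- Since `x t` may be only indifferent to `ω t`, `ε • 1` is added to obtain strict preference,
    -- and then `ε → 0`.
    have hlim : Filter.Tendsto (fun ε : ℝ => p ⬝ᵥ ((x t : Fin l → ℝ) + ε • 1))
        (nhdsWithin 0 (Set.Ioi 0)) (nhds (p ⬝ᵥ (x t : Fin l → ℝ))) := by
      have : ContinuousAt (fun ε : ℝ => p ⬝ᵥ (x t : Fin l → ℝ) + ε * (p ⬝ᵥ 1)) 0 := by fun_prop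
      simpa [dotProduct_add, dotProduct_smul] using this.tendsto.mono_left nhdsWithin_le_nhds
    refine ge_of_tendsto hlim ?_
    filter_upwards [self_mem_nhdsWithin] with ε hε
    have hε1 : (0 : Fin l → ℝ) < ε • 1 := smul_pos hε one_pos
    let y : Orthant l := ⟨(x t : Fin l → ℝ) + ε • 1, add_nonneg (x t).2 hε1.le⟩
    exact (hs y (Preference.strict_of_strict_of_weak (hmono t y (x t)
      (show (x t : Fin l → ℝ) < (x t : Fin l → ℝ) + ε • 1 from lt_add_of_pos_right _ hε1)) hw)).le
  have heq : (fun t => p ⬝ᵥ (E.ω t : Fin l → ℝ)) =ᵐ[E.μ] fun t => p ⬝ᵥ (x t : Fin l → ℝ) := by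
    rw [← integral_eq_iff_of_ae_le (integrable_dotProduct p E.alloc.2)
      (integrable_dotProduct p hxa.2) hge, integral_dotProduct p E.alloc.2,
      integral_dotProduct p hxa.2, hxint]
  refine ⟨⟨p, hp⟩, ⟨hxa, hxint⟩, ?_⟩
  filter_upwards [heq, hweak, hsupp] with t he hw hs
  exact ⟨he.ge, fun y hy => hs y (Preference.strict_of_strict_of_weak hy hw)⟩

end Economy

theorem mainTheorem3 {T : Type*} [MeasurableSpace T] {l : ℕ} (E : Economy T l)
    (hmono : ∀ t, (E.pref t).Monotonic)
    (hcont : ∀ t, (E.pref t).Continuous)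
    (hpos : ∀ i : Fin l, 0 < (∫ t, (E.ω t : Fin l → ℝ) ∂E.μ) i)
    (hatoms : HasFinitelyManyAtoms E.μ)
    (hconv : ∀ A, IsMeasureAtom E.μ A → ∀ᵐ t ∂(E.μ.restrict A), (E.pref t).IsConvex)
    (hpareto : E.IsParetoOptimal E.ω) :
    E.core = E.competitive := by
  refine Set.Subset.antisymm (fun x hx => ?_) E.competitive_subset_core
  rcases isEmpty_or_nonempty (Fin l) with hl | hl
  -- With no commodities there is a single bundle, so nothing is strictly preferred.
  · refine ⟨⟨0, le_rfl⟩, hx.1, ae_of_all _ fun t => ⟨by simp, fun y hy => ?_⟩⟩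
    have : y = x t := Subtype.ext (Subsingleton.elim _ _)
    exact absurd hy.1 (this ▸ hy.2)
  have h0 : E.μ Set.univ ≠ 0 := fun h => by
    have := hpos hl.some
    simp [Measure.measure_univ_eq_zero.1 h] at this
  obtain ⟨F, hF, hFatom, hFall⟩ := hatoms
  have hP : MeasurableSet (⋃₀ F) := MeasurableSet.sUnion hF.countable fun A hA => (hFatom A hA).1
  -- An atom off `⋃₀ F` would agree a.e. with a member of `F` disjoint from it, hence be null.
  have hA : ∀ A ⊆ (⋃₀ F)ᶜ, ¬ IsMeasureAtom E.μ A := by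
    intro A hAF hA
    obtain ⟨B, hB, hAB⟩ := hFall A hA
    refine hA.2.1 ?_
    have hdis : A ∩ B = ∅ := Set.disjoint_iff_inter_eq_empty.1 <|
      Set.disjoint_left.2 fun t htA htB => hAF htA ⟨B, hB, htB⟩
    have : E.μ (A ∩ A) = E.μ (A ∩ B) := measure_congr ((ae_eq_refl A).inter hAB)
    rwa [Set.inter_self, hdis, measure_empty] at this
  have hc : ∀ᵐ t ∂E.μ, t ∈ ⋃₀ F → (E.pref t).IsConvex := by
    have : ∀ᵐ t ∂E.μ, ∀ A ∈ F, t ∈ A → (E.pref t).IsConvex :=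
      (ae_ball_iff hF.countable).2 fun A hA =>
        (ae_restrict_iff' (hFatom A hA).1).1 (hconv A (hFatom A hA))
    filter_upwards [this] with t ht
    rintro ⟨A, hA, htA⟩
    exact ht A hA htA
  obtain ⟨p, hp, hp0, hsupp⟩ := hpareto.exists_supporting_price hmono h0 hP hA hc
  exact Economy.mem_competitive_of_mem_core hmono hp
    (Economy.ae_lt_of_supporting_price hmono hcont hpos hp hp0 hsupp) hx
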